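/- Let $\mathcal H$ be a real Hilbert space and let $A:\mathcal H\to 2^{\mathcal H}$ be maximally monotone with $\operatorname{zer}A=\{x : 0\in Ax\}\neq\varnothing$. For $c>0$ let $J_{cA}=(\mathrm{Id}+cA)^{-1}$ be the resolvent of $cA$. Let $u,x_0\in\mathcal H$, let $(\alpha_k),(\beta_k),(\gamma_k),(\delta_k)$ be sequences in $\mathbb R$, $(c_k)$ a sequence in $]0,\infty[$ and $(e_k)$ a sequence in $\mathcal H$, and let, for all $k\in\mathbb N$, $$x_{k+1}=\alpha_k u+\beta_k x_k+\gamma_k J_{c_kA}(x_k)+\delta_k e_k .$$ Put $\xi_k=\left|\beta_k+\frac{\gamma_k}{2}\right|+\left|\frac{\gamma_k}{2}\right|$. Suppose that $\sum_{k\in\mathbb N}(1-\xi_k^2)=\infty$ and that one of the following holds. (i) For all $k$: $|\alpha_k|+\xi_k\le 1$, $\beta_k+\gamma_k\ge 0$ and $\xi_k^2-\beta_k-\gamma_k\le 0$; $\sum_k|1-\alpha_k-\beta_k-\gamma_k|<\infty$ and $\sum_k\|\delta_ke_k\|<\infty$; $\alpha_k\to0$, $\beta_k\to0$, $\gamma_k\to1$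 and $c_k\to\infty$. (ii) For all $k$: $|\alpha_k|+\xi_k\le 1$, $\beta_k+\gamma_k\ge 0$ and $\xi_k^2-\beta_k-\gamma_k\le 0$; $\sum_k|1-\alpha_k-\beta_k-\gamma_k|<\infty$ and $\sum_k\|\delta_ke_k\|<\infty$; $\alpha_k\to0$, $\limsup_k|\beta_k|<1$, $0<\liminf_k\left(1-\beta_k-\frac{\gamma_k}{2}\right)\le\limsup_k\left(1-\beta_k-\frac{\gamma_k}{2}\right)<1$ and $1-\frac{c_k}{c_{k+1}}\to0$; and $\inf_kc_k>0$ or $c_k\to\infty$. (iii) For all $k$: $|\alpha_k|+\xi_k\le 1$, $\beta_k+\gamma_k\ge 0$, $\xi_k^2-\beta_k-\gamma_k\le 0$ and $|\gamma_k|\le1$; $\sum_k|(\alpha_{k+1}+\gamma_{k+1})-(\alpha_k+\gamma_k)|<\infty$, $\sum_k|1-\alpha_k-\beta_k-\gamma_k|<\infty$, $\sum_k|\beta_k|<\infty$, $\sum_k(1-|\gamma_k|)=\infty$ and $\sum_k\|\delta_ke_k\|<\infty$; either $\sum_k|\alpha_{k+1}-\alpha_k|<\infty$, or $|\gamma_k|\ne1$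 for all $k$ and $\frac{|\alpha_{k+1}-\alpha_k|}{1-|\gamma_{k+1}|}\to0$; $\alpha_k\to0$ and $\alpha_k+\gamma_k\to1$; $\inf_kc_k>0$ and $\sum_k|c_{k+1}-c_k|<\infty$. (iv) For all $k$: $\alpha_k\in\,]0,1]$ and $\alpha_k+\xi_k\le1$; $\alpha_k\to0$, $\beta_k\to0$, $\gamma_k\to1$, $\frac{\delta_ke_k}{\alpha_k}\to0$, $\frac{1-\alpha_k-\beta_k-\gamma_k}{\alpha_k}\to0$ and $c_k\to\infty$. Then $(x_k)$ converges strongly to $P_{\operatorname{zer}A}u$, the unique point of $\operatorname{zer}A$ nearest to $u$. -/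

import Mathlib

open Filter Topology
open scoped RealInnerProductSpace Pointwise

namespace SetValued

variable {H : Type*} [NormedAddCommGroup H]

/-- The set of zeros of a set-valued operator. -/
def zer (A : H → Set H) : Set H := {x | 0 ∈ A x}

/-- The inverse of a set-valued operator. -/
def inv (G : H → Set H) : H → Set H := fun w => {x | w ∈ G x}

/-- The resolvent `J_G = (Id + G)⁻¹` of a set-valued operator. -/
def resolvent (G : H → Set H) : H → Set H := inv (fun y => {y} + G y)

theorem mem_resolvent_iff {G : H → Set H} {x y : H} : y ∈ resolvent G x ↔ x - y ∈ G y := by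
  simp only [resolvent, inv, Set.mem_ofPred_eq, Set.singleton_add, Set.mem_image]
  constructor
  · rintro ⟨w, hw, rfl⟩
    simpa using hw
  · intro h
    exact ⟨x - y, h, by abel⟩

variable [InnerProductSpace ℝ H]

/-- A set-valued operator `A : H → 2^H` is maximally monotone: a pair `(x, w)` belongs to its graph
if and only if it is monotonically related to every pair of the graph. (The direction from left to
right is monotonicity, the other one says that no monotone operator has a strictly larger graph.) -/
def MaximallyMonotone (A : H → Set H) : Prop :=
  ∀ x w : H, w ∈ A x ↔ ∀ y v : H, v ∈ A y → 0 ≤ ⟪x - y, w - v⟫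

/-- Resolvents of positive multiples of a maximally monotone operator are at most single-valued, so
that "`y ∈ J_{cA} x`" means "`y = J_{cA} x`". -/
theorem MaximallyMonotone.resolvent_subsingleton {A : H → Set H} (hA : MaximallyMonotone A)
    {c : ℝ} (hc : 0 < c) (x : H) : (resolvent (c • A) x).Subsingleton := by
  intro y hy z hz
  rw [mem_resolvent_iff] at hy hz
  obtain ⟨v, hv, hv'⟩ := hy
  obtain ⟨w, hw, hw'⟩ := hz
  have h := (hA y v).1 hv z w hw
  have h1 : y - z = -(c • (v - w)) := by
    simp only at hv' hw'
    rw [smul_sub, hv', hw']; abel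
  have h2 : ⟪y - z, y - z⟫ ≤ 0 := by
    nth_rewrite 2 [h1]
    rw [inner_neg_right, inner_smul_right]
    have := mul_nonneg hc.le h
    linarith
  have h3 : ⟪y - z, y - z⟫ = 0 := le_antisymm h2 real_inner_self_nonneg
  exact sub_eq_zero.1 (inner_self_eq_zero.1 h3)

/-- `p` is the projection of `u` onto `C`: it is the one and only nearest point to `u` in `C`. -/
def IsProjection (C : Set H) (u p : H) : Prop :=
  ∀ q : H, (q ∈ C ∧ ∀ z ∈ C, ‖u - q‖ ≤ ‖u - z‖) ↔ q = p

/-- `(x k)` is generated by the generalized proximal point algorithm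
`x_{k+1} = α_k u + β_k x_k + γ_k J_{c_k A}(x_k) + δ_k e_k`. -/
def IsGeneralizedPPA (A : H → Set H) (u : H) (α β γ δ c : ℕ → ℝ) (e x : ℕ → H) : Prop :=
  ∀ k, ∃ y ∈ resolvent (c k • A) (x k),
    x (k + 1) = α k • u + β k • x k + γ k • y + δ k • e k

/-- The quantity `|β_k + γ_k / 2| + |γ_k / 2|`. -/
noncomputable def xi (β γ : ℕ → ℝ) (k : ℕ) : ℝ := |β k + γ k / 2| + |γ k / 2|

/-- The series `∑ a_k` of real numbers diverges to `+∞`. -/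
def SumEqTop (a : ℕ → ℝ) : Prop :=
  Tendsto (fun n => ∑ k ∈ Finset.range n, a k) atTop atTop

end SetValued

/-!
The points `x k` stay bounded, and the proof compares `s k = ‖x k - p‖ ^ 2`, where `p` is the
projection of `u` onto `zer A`, across one step in two ways.

* The reflected resolvent `2 J - Id` is nonexpansive and fixes `p`, so `β x + γ J x` is at distance
  at most `ξ ‖x - p‖` from `(β + γ) p`. This gives
  `s (k + 1) ≤ ξ ^ 2 * s k + (1 - ξ ^ 2) * τ k + σ k` with `σ` summable, where `τ k` is
  `2 * max 0 ⟪u - p, x (k + 1) - p⟫` up to a null sequence. Here `|α| ≤ 1 - ξ ≤ 1 - ξ ^ 2`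
  is used, and the negative parts of `α` are absorbed into the perturbations.
* Firm nonexpansiveness of `J`, together with `β + γ → 1` and `γ` bounded away from `0` and `2`,
  gives `s (k + 1) ≤ s k - κ * ‖x k - J (x k)‖ ^ 2 + μ k` with `κ > 0` and `μ k → 0`.

When `x k - J (x k)` is small, so is the element `(x k - J (x k)) / c k` of `A (J (x k))`. As weak
cluster points of such `J (x k)` are zeros of `A`, the variational inequality characterizing `p`
makes `τ k` asymptotically nonpositive along such indices
(`MaximallyMonotone.eventually_inner_lt`). When `x k - J (x k)` is not small, `s` decreases by a
fixed amount. Either way the excess of `s` over any `ε > 0` is contracted by a factor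
`1 - r * (1 - ξ ^ 2)` with a fixed `r > 0`, and the divergence of `∑ (1 - ξ ^ 2)` forces `s → 0`
(`tendsto_zero_of_contract_or_decrease`). In each of the four regimes `c` is eventually bounded
away from `0` and `γ` away from `0` and `2`, so all are instances of `tendsto_of_isGeneralizedPPA`.
-/

namespace SetValued

/-! ### Real sequences -/

theorem tendsto_zero_of_le_one_sub_mul {a l : ℕ → ℝ} (ha : ∀ k, 0 ≤ a k) {K : ℕ}
    (h : ∀ k ≥ K, a (k + 1) ≤ (1 - l k) * a k) (hl : SumEqTop l) : Tendsto a atTop (𝓝 0) := by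
  set S : ℕ → ℝ := fun n => ∑ k ∈ Finset.range n, l k with hS
  have key : ∀ n ≥ K, a n ≤ a K * Real.exp (S K) * Real.exp (-S n) := by
    intro n hn
    induction n, hn using Nat.le_induction with
    | base => rw [mul_assoc, ← Real.exp_add]; simp
    | succ n hn ih =>
      have h1 : 1 - l n ≤ Real.exp (-l n) := by linarith [Real.add_one_le_exp (-l n)]
      have h2 : -S (n + 1) = -l n + -S n := by simp only [hS, Finset.sum_range_succ]; ring
      calc a (n + 1) ≤ (1 - l n) * a n := h n hn
        _ ≤ Real.exp (-l n) * a n := mul_le_mul_of_nonneg_right h1 (ha n)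
        _ ≤ Real.exp (-l n) * (a K * Real.exp (S K) * Real.exp (-S n)) := by gcongr
        _ = _ := by rw [h2, Real.exp_add]; ring
  have hlim : Tendsto (fun n => a K * Real.exp (S K) * Real.exp (-S n)) atTop (𝓝 0) := by
    have := (Real.tendsto_exp_neg_atTop_nhds_zero.comp hl).const_mul (a K * Real.exp (S K))
    simpa using this
  exact tendsto_of_tendsto_of_tendsto_of_le_of_le' tendsto_const_nhds hlim
    (Eventually.of_forall ha) (eventually_atTop.2 ⟨K, key⟩)

/-- A sequence that at each step either contracts towards values at most `τ k` with weight `l k`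
or decreases by about `η k` tends to zero, provided that `τ` is asymptotically nonpositive along
the indices where `η` is small. The filter `atTop ⊓ comap η (𝓝 0)` stands for
"along every subsequence on which `η` tends to zero". -/
theorem tendsto_zero_of_contract_or_decrease {s l τ η μ : ℕ → ℝ} (hs : ∀ k, 0 ≤ s k)
    (hl0 : ∀ k, 0 ≤ l k) (hl1 : ∀ k, l k ≤ 1) (hl : SumEqTop l) (hη : ∀ k, 0 ≤ η k)
    (h1 : ∀ k, s (k + 1) ≤ (1 - l k) * s k + l k * τ k)
    (h2 : ∀ᶠ k in atTop, s (k + 1) ≤ s k - η k + μ k) (hμ : Tendsto μ atTop (𝓝 0))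
    (hτ : ∀ ε > 0, ∀ᶠ k in atTop ⊓ comap η (𝓝 0), τ k ≤ ε) : Tendsto s atTop (𝓝 0) := by
  -- For each `ε`, the excess of `s` over `ε` is eventually contracted by a factor
  -- `1 - r * l k`, whichever of the two alternatives occurs.
  have key : ∀ ε > 0, Tendsto (fun k => max (s k - ε) 0) atTop (𝓝 0) := by
    intro ε hε
    obtain ⟨d, hd, hτd⟩ : ∃ d > 0, ∀ᶠ k in atTop, η k < d → τ k ≤ ε := by
      have h := hτ ε hε
      rw [((atTop_basis (α := ℕ)).inf (Metric.nhds_basis_ball.comap η)).eventually_iff] at h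
      obtain ⟨⟨N, d⟩, ⟨-, hd⟩, hNd⟩ := h
      refine ⟨d, hd, eventually_atTop.2 ⟨N, fun k hk hkd => hNd ⟨hk, ?_⟩⟩⟩
      simpa [abs_of_nonneg (hη k)] using hkd
    obtain ⟨K, hK⟩ := eventually_atTop.1
      ((hτd.and h2).and (hμ.eventually (gt_mem_nhds (half_pos hd))))
    set a : ℕ → ℝ := fun k => max (s k - ε) 0 with ha
    have ha0 : ∀ k, 0 ≤ a k := fun k => le_max_right _ _
    have hsa : ∀ k, s k - ε ≤ a k := fun k => le_max_left _ _
    have hcase : ∀ k ≥ K, a (k + 1) ≤ (1 - l k) * a k ∨ a (k + 1) ≤ max (a k - d / 2) 0 := by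
      intro k hk
      obtain ⟨⟨hk1, hk2⟩, hk3⟩ := hK k hk
      rcases lt_or_ge (η k) d with hlt | hge
      · left
        refine max_le ?_ (mul_nonneg (sub_nonneg.2 (hl1 k)) (ha0 k))
        have e1 := mul_le_mul_of_nonneg_left (hk1 hlt) (hl0 k)
        have e2 := mul_le_mul_of_nonneg_left (hsa k) (sub_nonneg.2 (hl1 k))
        linarith [h1 k]
      · right
        refine max_le_max ?_ le_rfl
        linarith [hsa k]
    have hmono : ∀ k ≥ K, a (k + 1) ≤ a k := by
      intro k hk
      rcases hcase k hk with h | h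
      · have := mul_nonneg (hl0 k) (ha0 k)
        linarith
      · exact h.trans (max_le (by linarith) (ha0 k))
    have hbd : ∀ k ≥ K, a k ≤ a K := by
      intro k hk
      induction k, hk using Nat.le_induction with
      | base => exact le_rfl
      | succ n hn ih => exact (hmono n hn).trans ih
    -- On the range `[0, a K]`, subtracting `d / 2` contracts by the factor `1 - r`.
    have hM : 0 < a K + d := by linarith [ha0 K]
    set r : ℝ := d / 2 / (a K + d) with hr
    have hr0 : 0 < r := by positivity
    have hr1 : r ≤ 1 := by rw [hr, div_le_one hM]; linarith [ha0 K]
    have hrM : r * (a K + d) = d / 2 := by rw [hr]; field_simp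
    refine tendsto_zero_of_le_one_sub_mul (l := fun k => r * l k) (K := K) ha0 ?_ ?_
    · intro k hk
      rcases hcase k hk with h | h
      · have e := mul_le_mul_of_nonneg_right hr1 (mul_nonneg (hl0 k) (ha0 k))
        linarith
      · have e1 := mul_le_mul_of_nonneg_left (hl1 k) (mul_nonneg hr0.le (ha0 k))
        have e2 : r * a k ≤ d / 2 := by
          rw [← hrM]; exact mul_le_mul_of_nonneg_left (by linarith [hbd k hk]) hr0.le
        have e3 := mul_le_mul_of_nonneg_right hr1 (ha0 k)
        refine h.trans (max_le ?_ ?_) <;> nlinarith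
    · have := hl.const_mul_atTop hr0
      simpa only [SumEqTop, Finset.mul_sum] using this
  rw [Metric.tendsto_atTop]
  intro ε hε
  obtain ⟨N, hN⟩ := (Metric.tendsto_atTop.1 (key (ε / 2) (half_pos hε))) (ε / 2) (half_pos hε)
  refine ⟨N, fun n hn => ?_⟩
  have h := hN n hn
  rw [Real.dist_eq, sub_zero, abs_of_nonneg (le_max_right _ _)] at h
  have := (le_max_left (s n - ε / 2) 0)
  rw [Real.dist_eq, sub_zero, abs_of_nonneg (hs n)]
  linarith

/-- The previous criterion with an additional summable perturbation. -/
theorem tendsto_zero_of_contract_or_decrease_add {s l τ η μ σ : ℕ → ℝ} (hs : ∀ k, 0 ≤ s k)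
    (hl0 : ∀ k, 0 ≤ l k) (hl1 : ∀ k, l k ≤ 1) (hl : SumEqTop l) (hη : ∀ k, 0 ≤ η k)
    (hσ0 : ∀ k, 0 ≤ σ k) (hσ : Summable σ)
    (h1 : ∀ k, s (k + 1) ≤ (1 - l k) * s k + l k * τ k + σ k)
    (h2 : ∀ᶠ k in atTop, s (k + 1) ≤ s k - η k + μ k) (hμ : Tendsto μ atTop (𝓝 0))
    (hτ : ∀ ε > 0, ∀ᶠ k in atTop ⊓ comap η (𝓝 0), τ k ≤ ε) : Tendsto s atTop (𝓝 0) := by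
  -- Adding the tail of `∑ σ` to `s` absorbs the perturbation.
  set T : ℕ → ℝ := fun k => ∑' j, σ (j + k) with hT
  have hT0 : ∀ k, 0 ≤ T k := fun k => tsum_nonneg fun j => hσ0 _
  have hTs : ∀ k, T k = σ k + T (k + 1) := by
    intro k
    have h := ((summable_nat_add_iff k).2 hσ).tsum_eq_zero_add
    simp only [hT]
    rw [h, zero_add]
    congr 1
    refine tsum_congr fun j => ?_
    congr 1; ring
  have hTlim : Tendsto T atTop (𝓝 0) := tendsto_sum_nat_add σ
  have := tendsto_zero_of_contract_or_decrease (s := fun k => s k + T k) (l := l)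
    (τ := fun k => τ k + T k) (η := η) (μ := μ)
    (fun k => add_nonneg (hs k) (hT0 k)) hl0 hl1 hl hη
    (fun k => by have := h1 k; have := hTs k; linarith)
    (h2.mono fun k hk => by have := hTs k; have := hσ0 k; linarith) hμ
    (fun ε hε => by
      filter_upwards [hτ (ε / 2) (half_pos hε),
        (hTlim.mono_left inf_le_left).eventually (ge_mem_nhds (half_pos hε))] with k hk hk'
      linarith)
  simpa using this.sub hTlim

/-- A recursion of convex combinations with `M`, perturbed summably, stays bounded. -/
theorem bounded_of_le_convex_add {t w σ : ℕ → ℝ} {M : ℝ} (hw0 : ∀ k, 0 ≤ w k) (hw1 : ∀ k, w k ≤ 1)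
    (hσ0 : ∀ k, 0 ≤ σ k) (hσ : Summable σ)
    (h : ∀ k, t (k + 1) ≤ w k * t k + (1 - w k) * M + σ k) (k : ℕ) :
    t k ≤ max (t 0) M + ∑' j, σ j := by
  have key : ∀ n, t n ≤ max (t 0) M + ∑ j ∈ Finset.range n, σ j := by
    intro n
    induction n with
    | zero => simp
    | succ n ih =>
      rw [Finset.sum_range_succ]
      have hs : 0 ≤ ∑ j ∈ Finset.range n, σ j := Finset.sum_nonneg fun j _ => hσ0 j
      have h1 := mul_le_mul_of_nonneg_left ih (hw0 n)
      have h2 := mul_le_mul_of_nonneg_left (le_max_right (t 0) M) (sub_nonneg.2 (hw1 n))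
      have h3 := mul_le_mul_of_nonneg_right (hw1 n) hs
      linarith [h n]
  exact (key k).trans (by gcongr; exact hσ.sum_le_tsum _ fun j _ => hσ0 j)

/-! ### Zeros of maximally monotone operators -/

variable {H : Type*} [NormedAddCommGroup H] [InnerProductSpace ℝ H]

theorem MaximallyMonotone.mem_zer_iff {A : H → Set H} (hA : MaximallyMonotone A) {x : H} :
    x ∈ zer A ↔ ∀ y v : H, v ∈ A y → ⟪x - y, v⟫ ≤ 0 := by
  change 0 ∈ A x ↔ _
  rw [hA]
  simp only [zero_sub, inner_neg_right, Left.nonneg_neg_iff]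

theorem MaximallyMonotone.isClosed_zer {A : H → Set H} (hA : MaximallyMonotone A) :
    IsClosed (zer A) := by
  have : zer A = ⋂ (y : H) (v : H) (_ : v ∈ A y), {x | ⟪x - y, v⟫ ≤ 0} := by
    ext x
    simp only [Set.mem_iInter, hA.mem_zer_iff, Set.mem_ofPred_eq]
  rw [this]
  refine isClosed_iInter fun y => isClosed_iInter fun v => isClosed_iInter fun _ => ?_
  exact isClosed_le (by fun_prop) continuous_const

theorem MaximallyMonotone.convex_zer {A : H → Set H} (hA : MaximallyMonotone A) :
    Convex ℝ (zer A) := by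
  intro x hx z hz a b ha hb hab
  rw [hA.mem_zer_iff] at *
  intro y v hv
  have h : a • x + b • z - y = a • (x - y) + b • (z - y) := by
    rw [smul_sub, smul_sub, sub_add_sub_comm, ← add_smul, hab, one_smul]
  rw [h, inner_add_left, real_inner_smul_left, real_inner_smul_left]
  have h1 := mul_nonpos_of_nonneg_of_nonpos ha (hx y v hv)
  have h2 := mul_nonpos_of_nonneg_of_nonpos hb (hz y v hv)
  linarith

theorem exists_isProjection [CompleteSpace H] {C : Set H} (hne : C.Nonempty) (hcl : IsClosed C)
    (hconv : Convex ℝ C) (u : H) :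
    ∃ p ∈ C, IsProjection C u p ∧ ∀ z ∈ C, ⟪u - p, z - p⟫ ≤ 0 := by
  obtain ⟨p, hp, hmin⟩ := exists_norm_eq_iInf_of_complete_convex hne hcl.isComplete hconv u
  have hvar := (norm_eq_iInf_iff_real_inner_le_zero hconv hp).1 hmin
  -- The variational inequality makes `p` the strict minimizer.
  have hpyth : ∀ z ∈ C, ‖u - p‖ ^ 2 + ‖z - p‖ ^ 2 ≤ ‖u - z‖ ^ 2 := by
    intro z hz
    have h := norm_sub_sq_real (u - p) (z - p)
    rw [sub_sub_sub_cancel_right] at h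
    linarith [hvar z hz]
  have hnear : ∀ z ∈ C, ‖u - p‖ ≤ ‖u - z‖ := fun z hz =>
    le_of_sq_le_sq (by linarith [hpyth z hz, sq_nonneg ‖z - p‖]) (norm_nonneg _)
  refine ⟨p, hp, fun q => ⟨fun ⟨hq, hqmin⟩ => ?_, fun h => h ▸ ⟨hp, hnear⟩⟩, hvar⟩
  have h1 := hpyth q hq
  have h2 := pow_le_pow_left₀ (norm_nonneg _) (hqmin p hp) 2
  have h3 : ‖q - p‖ = 0 := pow_eq_zero_iff two_ne_zero |>.1 (by linarith [sq_nonneg ‖q - p‖])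
  exact sub_eq_zero.1 (norm_eq_zero.1 h3)

/-- Weak compactness of balls in a Hilbert space, phrased with ultrafilters. -/
theorem exists_weak_limit [CompleteSpace H] {ι : Type*} (U : Ultrafilter ι) {y : ι → H} {M : ℝ}
    (hy : ∀ i, ‖y i‖ ≤ M) : ∃ z : H, ∀ v, Tendsto (fun i => ⟪y i, v⟫) U (𝓝 ⟪z, v⟫) := by
  let f : ι → WeakDual ℝ H := fun i => StrongDual.toWeakDual (InnerProductSpace.toDual ℝ H (y i))
  have hmem : ∀ i, f i ∈ WeakDual.toStrongDual ⁻¹' Metric.closedBall (0 : StrongDual ℝ H) M := by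
    intro i
    simpa [f] using hy i
  obtain ⟨φ, -, hφ⟩ :=
    (WeakDual.isCompact_closedBall (𝕜 := ℝ) (0 : StrongDual ℝ H) M).ultrafilter_le_nhds
    (U.map f) (le_principal_iff.2 (Filter.mem_map.2 (Filter.univ_mem' hmem)))
  refine ⟨(InnerProductSpace.toDual ℝ H).symm (WeakDual.toStrongDual φ), fun v => ?_⟩
  have h := ((WeakDual.eval_continuous v).tendsto φ).comp (show Tendsto f U (𝓝 φ) from hφ)
  rw [InnerProductSpace.toDual_symm_apply]
  exact h

/-- The graph of a maximally monotone operator is closed under bounded limits that are weak in the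
point and strong in the value: this is what forces weak cluster points to be zeros. -/
theorem MaximallyMonotone.exists_weak_limit_mem_zer [CompleteSpace H] {A : H → Set H}
    (hA : MaximallyMonotone A) {ι : Type*} (U : Ultrafilter ι) {y w : ι → H} {M : ℝ}
    (hy : ∀ i, ‖y i‖ ≤ M) (hw : ∀ i, w i ∈ A (y i)) (hw0 : Tendsto w U (𝓝 0)) :
    ∃ z ∈ zer A, ∀ v, Tendsto (fun i => ⟪y i, v⟫) U (𝓝 ⟪z, v⟫) := by
  obtain ⟨z, hz⟩ := exists_weak_limit U hy
  refine ⟨z, hA.mem_zer_iff.2 fun b v hv => ?_, hz⟩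
  have h1 : Tendsto (fun i => ⟪y i - b, v⟫) U (𝓝 ⟪z - b, v⟫) := by
    simpa only [inner_sub_left] using (hz v).sub_const ⟪b, v⟫
  have h2 : Tendsto (fun i => (M + ‖b‖) * ‖w i‖) U (𝓝 0) := by
    simpa using hw0.norm.const_mul (M + ‖b‖)
  refine le_of_tendsto_of_tendsto h1 h2 (Eventually.of_forall fun i => ?_)
  have h3 := (hA _ _).1 (hw i) b v hv
  rw [inner_sub_right] at h3
  have h4 : ⟪y i - b, w i⟫ ≤ (M + ‖b‖) * ‖w i‖ :=
    (real_inner_le_norm _ _).trans (mul_le_mul_of_nonneg_right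
      ((norm_sub_le _ _).trans (by linarith [hy i])) (norm_nonneg _))
  linarith

theorem MaximallyMonotone.eventually_inner_lt [CompleteSpace H] {A : H → Set H}
    (hA : MaximallyMonotone A) {u p : H} (hp : ∀ z ∈ zer A, ⟪u - p, z - p⟫ ≤ 0)
    {ι : Type*} {F : Filter ι} {y w : ι → H} {M : ℝ}
    (hy : ∀ i, ‖y i‖ ≤ M) (hw : ∀ i, w i ∈ A (y i)) (hw0 : Tendsto w F (𝓝 0))
    {ε : ℝ} (hε : 0 < ε) : ∀ᶠ i in F, ⟪u - p, y i - p⟫ < ε := by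
  by_contra hcon
  have hfr : ∃ᶠ i in F, ε ≤ ⟪u - p, y i - p⟫ := by
    simpa only [Filter.Frequently, not_le] using hcon
  have := frequently_iff_neBot.1 hfr
  let U := Ultrafilter.of (F ⊓ 𝓟 {i | ε ≤ ⟪u - p, y i - p⟫})
  have hUle : (U : Filter ι) ≤ F ⊓ 𝓟 {i | ε ≤ ⟪u - p, y i - p⟫} := Ultrafilter.of_le _
  have hUF : (U : Filter ι) ≤ F := hUle.trans inf_le_left
  have hU : ∀ᶠ i in (U : Filter ι), ε ≤ ⟪u - p, y i - p⟫ :=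
    le_principal_iff.1 (hUle.trans inf_le_right)
  obtain ⟨z, hz, hlim⟩ := hA.exists_weak_limit_mem_zer U hy hw (hw0.mono_left hUF)
  have h1 : Tendsto (fun i => ⟪u - p, y i - p⟫) U (𝓝 ⟪u - p, z - p⟫) := by
    have := (hlim (u - p)).sub_const ⟪p, u - p⟫
    simp only [← inner_sub_left] at this
    simpa only [real_inner_comm] using this
  linarith [ge_of_tendsto h1 hU, hp z hz]

/-- Firm nonexpansiveness of the resolvent, relative to the fixed point `z`. -/
theorem MaximallyMonotone.inner_resolvent_nonneg {A : H → Set H} (hA : MaximallyMonotone A)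
    {c : ℝ} (hc : 0 < c) {x y z : H} (hy : y ∈ resolvent (c • A) x) (hz : z ∈ zer A) :
    0 ≤ ⟪x - y, y - z⟫ := by
  rw [mem_resolvent_iff] at hy
  obtain ⟨w, hw, hw'⟩ := hy
  have hw'' : c • w = x - y := hw'
  have h := hA.mem_zer_iff.1 hz y w hw
  rw [← hw'', real_inner_smul_left]
  refine mul_nonneg hc.le ?_
  rw [← neg_sub, inner_neg_right, real_inner_comm]
  linarith

/-! ### One step of the iteration -/

/-- Writing `β a + γ b = (β + γ / 2) a + (γ / 2) (2 b - a)`, where `‖2 b - a‖ ≤ ‖a‖`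
expresses that the reflected resolvent is nonexpansive. -/
theorem norm_smul_add_smul_le {a b : H} (h : 0 ≤ ⟪a - b, b⟫) (β γ : ℝ) :
    ‖β • a + γ • b‖ ≤ (|β + γ / 2| + |γ / 2|) * ‖a‖ := by
  have hr : ‖(2 : ℝ) • b - a‖ ≤ ‖a‖ := by
    refine le_of_sq_le_sq ?_ (norm_nonneg _)
    rw [inner_sub_left, real_inner_self_eq_norm_sq] at h
    rw [norm_sub_sq_real, norm_smul, real_inner_smul_left, real_inner_comm, Real.norm_eq_abs,
      abs_two]
    nlinarith
  have he : β • a + γ • b = (β + γ / 2) • a + (γ / 2) • ((2 : ℝ) • b - a) := by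
    module
  rw [he, add_mul]
  refine (norm_add_le _ _).trans ?_
  rw [norm_smul, norm_smul, Real.norm_eq_abs, Real.norm_eq_abs]
  gcongr

/-- A quantitative refinement of the nonexpansiveness estimate: the displacement `a - b` is
what the squared norm loses. -/
theorem norm_sq_smul_add_smul_le {a b : H} (h : 0 ≤ ⟪a - b, b⟫) {β γ : ℝ} (hβγ : 0 ≤ γ * (β + γ)) :
    ‖β • a + γ • b‖ ^ 2 ≤ (β + γ) ^ 2 * ‖a‖ ^ 2 - γ * (2 * β + γ) * ‖a - b‖ ^ 2 := by
  have he : β • a + γ • b = (β + γ) • a - γ • (a - b) := by module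
  have h1 : ‖a - b‖ ^ 2 ≤ ⟪a, a - b⟫ := by
    have : ⟪a, a - b⟫ = ⟪a - b, a - b⟫ + ⟪a - b, b⟫ := by
      rw [real_inner_comm, ← inner_add_right, sub_add_cancel]
    rw [this, real_inner_self_eq_norm_sq]; linarith
  rw [he, norm_sub_sq_real, norm_smul, norm_smul, real_inner_smul_left, real_inner_smul_right,
    Real.norm_eq_abs, Real.norm_eq_abs, mul_pow, mul_pow, sq_abs, sq_abs]
  nlinarith [mul_le_mul_of_nonneg_left h1 hβγ]

theorem norm_sq_add_le (a r : H) : ‖a + r‖ ^ 2 ≤ ‖a‖ ^ 2 + 2 * ⟪r, a + r⟫ := by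
  rw [norm_add_sq_real, inner_add_right, real_inner_self_eq_norm_sq, real_inner_comm]
  nlinarith [sq_nonneg ‖r‖]

theorem abs_add_le_xi (β γ : ℕ → ℝ) (k : ℕ) : |β k + γ k| ≤ xi β γ k := by
  have : β k + γ k = (β k + γ k / 2) + γ k / 2 := by ring
  rw [this]
  exact abs_add_le _ _

theorem abs_le_xi (β γ : ℕ → ℝ) (k : ℕ) : |β k| ≤ xi β γ k := by
  have : β k = (β k + γ k / 2) - γ k / 2 := by ring
  rw [this]
  exact abs_sub _ _

theorem xi_nonneg (β γ : ℕ → ℝ) (k : ℕ) : 0 ≤ xi β γ k := by unfold xi; positivity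

/-! ### Convergence -/

/-- Strong convergence of the generalized proximal point algorithm to the point `p` of `zer A`
characterized by the variational inequality `hp`. The perturbations `1 - α - β - γ` and `δ e` may be
negligible relative to `1 - ξ` (through `ρ`), summable (through `σ`), or a combination of both, and
the resolvent parameters need only stay away from `0`. -/
theorem tendsto_of_isGeneralizedPPA [CompleteSpace H] {A : H → Set H} (hA : MaximallyMonotone A)
    {u p : H} (hpA : p ∈ zer A) (hp : ∀ z ∈ zer A, ⟪u - p, z - p⟫ ≤ 0)
    {α β γ δ c : ℕ → ℝ} (hc : ∀ k, 0 < c k) {e x : ℕ → H}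
    (hx : IsGeneralizedPPA A u α β γ δ c e x) (hsum : SumEqTop (fun k => 1 - xi β γ k ^ 2))
    (hξ : ∀ k, |α k| + xi β γ k ≤ 1) (hα : Tendsto α atTop (𝓝 0))
    {ρ σ : ℕ → ℝ} (hρ0 : ∀ k, 0 ≤ ρ k) (hρ : Tendsto ρ atTop (𝓝 0))
    (hσ0 : ∀ k, 0 ≤ σ k) (hσ : Summable σ)
    (hdef : ∀ k, |1 - α k - β k - γ k| ≤ (1 - xi β γ k) * ρ k + σ k)
    (herr : ∀ k, ‖δ k • e k‖ ≤ (1 - xi β γ k) * ρ k + σ k)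
    {θ : ℝ} (hθ : 0 < θ) (hγ : ∀ᶠ k in atTop, θ ≤ γ k ∧ γ k ≤ 2 - θ)
    {c₀ : ℝ} (hc₀ : 0 < c₀) (hcc : ∀ᶠ k in atTop, c₀ ≤ c k) :
    Tendsto x atTop (𝓝 p) := by
  choose y hy hxs using hx
  set a : ℕ → H := fun k => x k - p with ha
  set b : ℕ → H := fun k => y k - p with hb
  set g : ℕ → ℝ := fun k => (1 - xi β γ k) * ρ k + σ k with hg
  set r : ℕ → H := fun k => α k • (u - p) + (α k + β k + γ k - 1) • p + δ k • e k with hr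
  have hab : ∀ k, a k - b k = x k - y k := fun k => sub_sub_sub_cancel_right _ _ _
  have hfirm : ∀ k, 0 ≤ ⟪a k - b k, b k⟫ := fun k => by
    rw [hab]; exact hA.inner_resolvent_nonneg (hc k) (hy k) hpA
  have hstep : ∀ k, a (k + 1) = (β k • a k + γ k • b k) + r k := fun k => by
    simp only [ha, hb, hr, hxs]; module
  have hξ0 := xi_nonneg β γ
  have hαξ : ∀ k, |α k| ≤ 1 - xi β γ k := fun k => by linarith [hξ k]
  have hξ1 : ∀ k, xi β γ k ≤ 1 := fun k => by linarith [hξ k, abs_nonneg (α k)]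
  have hg0 : ∀ k, 0 ≤ g k := fun k =>
    add_nonneg (mul_nonneg (sub_nonneg.2 (hξ1 k)) (hρ0 k)) (hσ0 k)
  have hglim : Tendsto g atTop (𝓝 0) := by
    refine squeeze_zero hg0 (fun k => ?_) (by simpa using hρ.add hσ.tendsto_atTop_zero)
    have := mul_nonneg (hξ0 k) (hρ0 k)
    simp only [hg]; linarith
  have herr' : ∀ k, ‖(α k + β k + γ k - 1) • p + δ k • e k‖ ≤ (‖p‖ + 1) * g k := fun k => by
    refine (norm_add_le _ _).trans ?_
    rw [norm_smul, Real.norm_eq_abs, ← abs_neg]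
    have h1 : -(α k + β k + γ k - 1) = 1 - α k - β k - γ k := by ring
    rw [h1]
    have := mul_le_mul_of_nonneg_right (hdef k) (norm_nonneg p)
    linarith [herr k]
  have hrsplit : ∀ k, r k = α k • (u - p) + ((α k + β k + γ k - 1) • p + δ k • e k) :=
    fun k => add_assoc _ _ _
  have hrn : ∀ k, ‖r k‖ ≤ |α k| * ‖u - p‖ + (‖p‖ + 1) * g k := fun k => by
    rw [hrsplit]
    refine (norm_add_le _ _).trans ?_
    rw [norm_smul, Real.norm_eq_abs]
    exact add_le_add le_rfl (herr' k)
  have hrlim : Tendsto (fun k => ‖r k‖) atTop (𝓝 0) := by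
    refine squeeze_zero (fun _ => norm_nonneg _) hrn ?_
    simpa using (hα.abs.mul_const ‖u - p‖).add (hglim.const_mul (‖p‖ + 1))
  obtain ⟨B, hB⟩ : ∃ B, ∀ k, ‖a k‖ ≤ B := by
    obtain ⟨R, hR⟩ := hρ.bddAbove_range
    refine ⟨_, bounded_of_le_convex_add (t := fun k => ‖a k‖) (w := xi β γ)
      (σ := fun k => (‖p‖ + 1) * σ k) (M := ‖u - p‖ + (‖p‖ + 1) * R) hξ0 hξ1
      (fun k => mul_nonneg (by positivity) (hσ0 k)) (hσ.mul_left _) fun k => ?_⟩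
    have h1 := norm_add_le (β k • a k + γ k • b k) (r k)
    rw [← hstep] at h1
    have h2 := norm_smul_add_smul_le (hfirm k) (β k) (γ k)
    have h3 := mul_le_mul_of_nonneg_right (hαξ k) (norm_nonneg (u - p))
    have h4 : (‖p‖ + 1) * ((1 - xi β γ k) * ρ k) ≤ (‖p‖ + 1) * ((1 - xi β γ k) * R) :=
      mul_le_mul_of_nonneg_left (mul_le_mul_of_nonneg_left (hR ⟨k, rfl⟩)
        (sub_nonneg.2 (hξ1 k))) (by positivity)
    have h5 := hrn k
    simp only [hg] at h5
    change _ ≤ xi β γ k * ‖a k‖ at h2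
    linarith
  have hB0 : 0 ≤ B := (norm_nonneg _).trans (hB 0)
  have hbB : ∀ k, ‖b k‖ ≤ B := fun k => by
    have h := norm_smul_add_smul_le (hfirm k) 0 1
    norm_num at h
    exact h.trans (hB k)
  have hβγ : Tendsto (fun k => β k + γ k) atTop (𝓝 1) := by
    have h1 : Tendsto (fun k => 1 - α k - β k - γ k) atTop (𝓝 0) :=
      squeeze_zero_norm hdef hglim
    have h2 := (hα.const_sub 1).sub h1
    simp only [sub_zero] at h2
    exact h2.congr fun k => by ring
  have hβ1 : ∀ k, |β k| ≤ 1 := fun k => (abs_le_xi β γ k).trans (hξ1 k)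
  -- Since `β + γ ≤ ξ ≤ 1 - |α|`, the negative parts of `α` are
  -- controlled by `1 - α - β - γ`.
  have hαneg : ∀ k, |α k| - α k ≤ g k := fun k => by
    have h1 := (le_abs_self _).trans (abs_add_le_xi β γ k)
    have h2 := (le_abs_self _).trans (hdef k)
    linarith [hξ k]
  set m : ℕ → ℝ := fun k => max 0 ⟪u - p, a (k + 1)⟫ with hm
  have hrin : ∀ k, ⟪r k, a (k + 1)⟫ ≤ |α k| * m k + (‖u - p‖ + ‖p‖ + 1) * B * g k := fun k => by
    have h1 : ⟪r k, a (k + 1)⟫ = α k * ⟪u - p, a (k + 1)⟫ +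
        ⟪(α k + β k + γ k - 1) • p + δ k • e k, a (k + 1)⟫ := by
      rw [hrsplit, inner_add_left, real_inner_smul_left]
    have h2 : ⟪(α k + β k + γ k - 1) • p + δ k • e k, a (k + 1)⟫ ≤ (‖p‖ + 1) * g k * B :=
      (real_inner_le_norm _ _).trans (mul_le_mul (herr' k) (hB _) (norm_nonneg _)
        (mul_nonneg (by positivity) (hg0 k)))
    have h3 : |α k| * ⟪u - p, a (k + 1)⟫ ≤ |α k| * m k :=
      mul_le_mul_of_nonneg_left (le_max_right _ _) (abs_nonneg _)
    have h4 : -⟪u - p, a (k + 1)⟫ ≤ ‖u - p‖ * B := by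
      refine (neg_le_abs _).trans ((abs_real_inner_le_norm _ _).trans ?_)
      exact mul_le_mul_of_nonneg_left (hB _) (norm_nonneg _)
    have h5 := mul_le_mul_of_nonneg_left h4 (sub_nonneg.2 (le_abs_self (α k)))
    have h6 := mul_le_mul_of_nonneg_right (hαneg k) (mul_nonneg (norm_nonneg (u - p)) hB0)
    rw [h1]
    linarith
  set C : ℝ := 2 * ((‖u - p‖ + ‖p‖ + 1) * B) with hC
  have hC0 : 0 ≤ C := by positivity
  have hl0 : ∀ k, 1 - xi β γ k ≤ 1 - xi β γ k ^ 2 := fun k => by nlinarith [hξ0 k, hξ1 k]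
  set κ : ℝ := θ ^ 2 / 2 with hκ
  have hκ0 : 0 < κ := by positivity
  have hmain : Tendsto (fun k => ‖a k‖ ^ 2) atTop (𝓝 0) := by
    refine tendsto_zero_of_contract_or_decrease_add (l := fun k => 1 - xi β γ k ^ 2)
      (τ := fun k => 2 * m k + C * ρ k) (η := fun k => κ * ‖a k - b k‖ ^ 2)
      (μ := fun k => 2 * ‖r k‖ * B) (σ := fun k => C * σ k) (fun k => by positivity)
      (fun k => (sub_nonneg.2 (hξ1 k)).trans (hl0 k)) (fun k => by linarith [sq_nonneg (xi β γ k)])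
      hsum (fun k => by positivity) (fun k => mul_nonneg hC0 (hσ0 k)) (hσ.mul_left C)
      (fun k => ?_) ?_ ?_ ?_
    · have h1 := norm_sq_add_le (β k • a k + γ k • b k) (r k)
      rw [← hstep] at h1
      have h2 := pow_le_pow_left₀ (norm_nonneg _) (norm_smul_add_smul_le (hfirm k) (β k) (γ k)) 2
      change _ ≤ (xi β γ k * ‖a k‖) ^ 2 at h2
      have h3 := hrin k
      have h4 := mul_le_mul_of_nonneg_right ((hαξ k).trans (hl0 k))
        (le_max_left 0 ⟪u - p, a (k + 1)⟫)
      have h5 := mul_le_mul_of_nonneg_left (mul_le_mul_of_nonneg_right (hl0 k) (hρ0 k)) hC0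
      have h6 : (‖u - p‖ + ‖p‖ + 1) * B * g k = C * g k / 2 := by rw [hC]; ring
      rw [h6] at h3
      simp only [hg] at h3
      change _ ≤ (1 - xi β γ k ^ 2) * m k at h4
      rw [mul_pow] at h2
      linarith
    -- `γ (2 β + γ) ≥ κ` because `2 β + γ = 2 (β + γ) - γ` with `β + γ → 1` and `γ ≤ 2 - θ`.
    · filter_upwards [hγ, hβγ.eventually (lt_mem_nhds (show 1 - min (θ / 4) 1 < 1 by
        have : 0 < min (θ / 4) 1 := by positivity
        linarith))] with k hk1 hk2
      have hm1 := min_le_left (θ / 4) 1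
      have hm2 := min_le_right (θ / 4) 1
      have hs0 : 0 ≤ β k + γ k := by linarith
      have h1 := norm_sq_add_le (β k • a k + γ k • b k) (r k)
      rw [← hstep] at h1
      have h2 := norm_sq_smul_add_smul_le (hfirm k) (mul_nonneg (hθ.le.trans hk1.1) hs0)
      have h3 : ⟪r k, a (k + 1)⟫ ≤ ‖r k‖ * B :=
        (real_inner_le_norm _ _).trans (mul_le_mul_of_nonneg_left (hB _) (norm_nonneg _))
      have h4 : (β k + γ k) ^ 2 ≤ 1 := by
        have := (le_abs_self _).trans ((abs_add_le_xi β γ k).trans (hξ1 k))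
        nlinarith
      have h5 := mul_le_mul_of_nonneg_right h4 (sq_nonneg ‖a k‖)
      have h6 : κ ≤ γ k * (2 * β k + γ k) := by
        have : θ * (θ / 2) ≤ γ k * (2 * β k + γ k) :=
          mul_le_mul hk1.1 (by linarith [hk1.2]) (by positivity) (hθ.le.trans hk1.1)
        rw [hκ]; linarith
      have h7 := mul_le_mul_of_nonneg_right h6 (sq_nonneg ‖a k - b k‖)
      linarith
    · simpa using (hrlim.const_mul 2).mul_const B
    · intro ε hε
      set F : Filter ℕ := atTop ⊓ comap (fun k => κ * ‖a k - b k‖ ^ 2) (𝓝 0) with hF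
      have hFle : F ≤ atTop := inf_le_left
      have hdlim : Tendsto (fun k => ‖a k - b k‖) F (𝓝 0) := by
        have h1 : Tendsto (fun k => κ * ‖a k - b k‖ ^ 2) F (𝓝 0) :=
          tendsto_comap.mono_left inf_le_right
        have h2 := (h1.const_mul κ⁻¹).sqrt
        rw [mul_zero, Real.sqrt_zero] at h2
        refine h2.congr fun k => ?_
        rw [inv_mul_cancel_left₀ hκ0.ne', Real.sqrt_sq (norm_nonneg _)]
      choose w hw hwy using fun k => (mem_resolvent_iff.1 (hy k))
      have hwlim : Tendsto w F (𝓝 0) := by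
        have h1 : Tendsto (fun k => ‖a k - b k‖ / c₀) F (𝓝 0) := by simpa using hdlim.div_const c₀
        refine squeeze_zero_norm' ?_ h1
        filter_upwards [hcc.filter_mono hFle] with k hk
        have h2 : c k • w k = a k - b k := (hwy k).trans (hab k).symm
        rw [le_div_iff₀ hc₀, ← h2, norm_smul, Real.norm_eq_abs, abs_of_pos (hc k), mul_comm]
        gcongr
      have hyB : ∀ k, ‖y k‖ ≤ B + ‖p‖ := fun k => by
        have := norm_add_le (b k) p
        simp only [hb, sub_add_cancel] at this
        exact this.trans (add_le_add (hbB k) le_rfl)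
      have hdist : Tendsto (fun k => ‖u - p‖ * ‖a (k + 1) - b k‖) F (𝓝 0) := by
        have h1 : Tendsto (fun k => ‖a k - b k‖ + |β k + γ k - 1| * B + ‖r k‖) F (𝓝 0) := by
          have h2 := ((hβγ.sub_const 1).abs.mul_const B).mono_left hFle
          simpa using (hdlim.add h2).add (hrlim.mono_left hFle)
        have h3 : Tendsto (fun k => ‖a (k + 1) - b k‖) F (𝓝 0) := by
          refine squeeze_zero (fun _ => norm_nonneg _) (fun k => ?_) h1
          have h4 : a (k + 1) - b k = β k • (a k - b k) + (β k + γ k - 1) • b k + r k := by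
            rw [hstep]; module
          rw [h4]
          refine (norm_add₃_le).trans ?_
          rw [norm_smul, norm_smul, Real.norm_eq_abs, Real.norm_eq_abs]
          have h5 := mul_le_mul_of_nonneg_right (hβ1 k) (norm_nonneg (a k - b k))
          have h6 := mul_le_mul_of_nonneg_left (hbB k) (abs_nonneg (β k + γ k - 1))
          linarith
        simpa using h3.const_mul ‖u - p‖
      have hCρ : Tendsto (fun k => C * ρ k) F (𝓝 0) := by
        simpa using (hρ.mono_left hFle).const_mul C
      have hε8 : 0 < ε / 8 := by positivity
      filter_upwards [hA.eventually_inner_lt hp hyB hw hwlim hε8,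
        hdist.eventually (gt_mem_nhds hε8), hCρ.eventually (gt_mem_nhds (half_pos hε))]
        with k h1 h2 h3
      have h4 : ⟪u - p, a (k + 1)⟫ = ⟪u - p, b k⟫ + ⟪u - p, a (k + 1) - b k⟫ := by
        rw [← inner_add_right, add_sub_cancel]
      have h5 := real_inner_le_norm (u - p) (a (k + 1) - b k)
      have h6 : m k ≤ ε / 4 := max_le (by positivity) (by rw [h4]; linarith)
      linarith
  have h := hmain.sqrt
  simp only [Real.sqrt_zero, Real.sqrt_sq (norm_nonneg _)] at h
  exact tendsto_iff_norm_sub_tendsto_zero.2 h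

end SetValued

theorem theorem4p4 {H : Type*} [NormedAddCommGroup H] [InnerProductSpace ℝ H] [CompleteSpace H]
    (A : H → Set H) (hA : SetValued.MaximallyMonotone A) (hzer : (SetValued.zer A).Nonempty)
    (u : H) (α β γ δ c : ℕ → ℝ) (hc : ∀ k, 0 < c k) (e x : ℕ → H)
    (hx : SetValued.IsGeneralizedPPA A u α β γ δ c e x)
    (hsum : SetValued.SumEqTop (fun k => 1 - SetValued.xi β γ k ^ 2))
    (hreg :
      -- first regime
      ((∀ k, |α k| + SetValued.xi β γ k ≤ 1) ∧
        (∀ k, 0 ≤ β k + γ k) ∧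
        (∀ k, SetValued.xi β γ k ^ 2 - β k - γ k ≤ 0) ∧
        Summable (fun k => |1 - α k - β k - γ k|) ∧
        Summable (fun k => ‖δ k • e k‖) ∧
        Tendsto α atTop (𝓝 0) ∧ Tendsto β atTop (𝓝 0) ∧ Tendsto γ atTop (𝓝 1) ∧
        Tendsto c atTop atTop) ∨
      -- second regime
      ((∀ k, |α k| + SetValued.xi β γ k ≤ 1) ∧
        (∀ k, 0 ≤ β k + γ k) ∧
        (∀ k, SetValued.xi β γ k ^ 2 - β k - γ k ≤ 0) ∧
        Summable (fun k => |1 - α k - β k - γ k|) ∧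
        Summable (fun k => ‖δ k • e k‖) ∧
        Tendsto α atTop (𝓝 0) ∧
        limsup (fun k => ((|β k| : ℝ) : EReal)) atTop < 1 ∧
        0 < liminf (fun k => ((1 - β k - γ k / 2 : ℝ) : EReal)) atTop ∧
        limsup (fun k => ((1 - β k - γ k / 2 : ℝ) : EReal)) atTop < 1 ∧
        Tendsto (fun k => 1 - c k / c (k + 1)) atTop (𝓝 0) ∧
        (0 < ⨅ k, c k ∨ Tendsto c atTop atTop)) ∨
      -- third regime
      ((∀ k, |α k| + SetValued.xi β γ k ≤ 1) ∧
        (∀ k, 0 ≤ β k + γ k) ∧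
        (∀ k, SetValued.xi β γ k ^ 2 - β k - γ k ≤ 0) ∧
        (∀ k, |γ k| ≤ 1) ∧
        Summable (fun k => |(α (k + 1) + γ (k + 1)) - (α k + γ k)|) ∧
        Summable (fun k => |1 - α k - β k - γ k|) ∧
        Summable (fun k => |β k|) ∧
        SetValued.SumEqTop (fun k => 1 - |γ k|) ∧
        Summable (fun k => ‖δ k • e k‖) ∧
        (Summable (fun k => |α (k + 1) - α k|) ∨
          ((∀ k, |γ k| ≠ 1) ∧
            Tendsto (fun k => |α (k + 1) - α k| / (1 - |γ (k + 1)|)) atTop (𝓝 0))) ∧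
        Tendsto α atTop (𝓝 0) ∧
        Tendsto (fun k => α k + γ k) atTop (𝓝 1) ∧
        0 < ⨅ k, c k ∧
        Summable (fun k => |c (k + 1) - c k|)) ∨
      -- fourth regime
      ((∀ k, 0 < α k ∧ α k ≤ 1) ∧
        (∀ k, α k + SetValued.xi β γ k ≤ 1) ∧
        Tendsto α atTop (𝓝 0) ∧ Tendsto β atTop (𝓝 0) ∧ Tendsto γ atTop (𝓝 1) ∧
        Tendsto (fun k => (α k)⁻¹ • (δ k • e k)) atTop (𝓝 0) ∧
        Tendsto (fun k => (1 - α k - β k - γ k) / α k) atTop (𝓝 0) ∧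
        Tendsto c atTop atTop)) :
    ∃ p : H, SetValued.IsProjection (SetValued.zer A) u p ∧ Tendsto x atTop (𝓝 p) := by
  obtain ⟨p, hpA, hproj, hp⟩ :=
    SetValued.exists_isProjection hzer hA.isClosed_zer hA.convex_zer u
  refine ⟨p, hproj, ?_⟩
  -- The first three regimes share summable defects, `γ` bounded away from `0` and `2`, and `c`
  -- bounded away from `0`.
  have summable_case : (∀ k, |α k| + SetValued.xi β γ k ≤ 1) →
      Summable (fun k => |1 - α k - β k - γ k|) → Summable (fun k => ‖δ k • e k‖) →
      Tendsto α atTop (𝓝 0) → (∃ θ > 0, ∀ᶠ k in atTop, θ ≤ γ k ∧ γ k ≤ 2 - θ) →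
      (∃ c₀ > 0, ∀ᶠ k in atTop, c₀ ≤ c k) → Tendsto x atTop (𝓝 p) := by
    rintro hξ hdef herr hα ⟨θ, hθ, hγ⟩ ⟨c₀, hc₀, hcc⟩
    refine SetValued.tendsto_of_isGeneralizedPPA hA hpA hp hc hx hsum hξ hα (ρ := fun _ => 0)
      (σ := fun k => |1 - α k - β k - γ k| + ‖δ k • e k‖) (fun _ => le_rfl) tendsto_const_nhds
      (fun _ => by positivity) (hdef.add herr) (fun k => ?_) (fun k => ?_) hθ hγ hc₀ hcc
    · simp
    · simp
  have of_tendsto_one : Tendsto γ atTop (𝓝 1) →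
      ∃ θ > 0, ∀ᶠ k in atTop, θ ≤ γ k ∧ γ k ≤ 2 - θ := fun hγ => by
    refine ⟨1 / 2, by norm_num, ?_⟩
    filter_upwards [hγ.eventually (lt_mem_nhds (show (1 / 2 : ℝ) < 1 by norm_num)),
      hγ.eventually (gt_mem_nhds (show (1 : ℝ) < 3 / 2 by norm_num))] with k h1 h2
    constructor <;> linarith
  have of_atTop : Tendsto c atTop atTop → ∃ c₀ > 0, ∀ᶠ k in atTop, c₀ ≤ c k := fun h =>
    ⟨1, one_pos, h.eventually_ge_atTop 1⟩
  have of_iInf : 0 < ⨅ k, c k → ∃ c₀ > 0, ∀ᶠ k in atTop, c₀ ≤ c k := fun h =>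
    ⟨_, h, Eventually.of_forall fun k =>
      ciInf_le ⟨0, by rintro _ ⟨j, rfl⟩; exact (hc j).le⟩ k⟩
  rcases hreg with ⟨hξ, -, -, hdef, herr, hα, -, hγ, hcc⟩ |
    ⟨hξ, -, -, hdef, herr, hα, -, hinf, hsup, -, hcc⟩ |
    ⟨hξ, -, -, -, -, hdef, -, -, herr, -, hα, hαγ, hcc, -⟩ |
    ⟨hα01, hξ, hα, -, hγ, herr, hdef, hcc⟩
  · exact summable_case hξ hdef herr hα (of_tendsto_one hγ) (of_atTop hcc)
  · refine summable_case hξ hdef herr hα ?_ (hcc.elim of_iInf of_atTop)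
    obtain ⟨s, hs0, hs⟩ := EReal.lt_iff_exists_real_btwn.1 hinf
    obtain ⟨t, ht, ht1⟩ := EReal.lt_iff_exists_real_btwn.1 hsup
    have hs0' : 0 < s := EReal.coe_pos.1 hs0
    have ht1' : t < 1 := by exact_mod_cast ht1
    -- Up to a null sequence, `1 - β - γ / 2` is `γ / 2`.
    have hβγ : Tendsto (fun k => 1 - β k - γ k) atTop (𝓝 0) := by
      have h := (tendsto_zero_iff_abs_tendsto_zero _).2 hdef.tendsto_atTop_zero
      have h' := h.add hα
      simp only [add_zero] at h'
      exact h'.congr fun k => by ring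
    have hmin : 0 < min s (1 - t) := lt_min hs0' (by linarith)
    refine ⟨min s (1 - t), hmin, ?_⟩
    filter_upwards [eventually_lt_of_lt_liminf hs, eventually_lt_of_limsup_lt ht,
      hβγ.eventually (gt_mem_nhds (half_pos hmin)),
      hβγ.eventually (lt_mem_nhds (neg_lt_zero.2 (half_pos hmin)))] with k h1 h2 h3 h4
    rw [EReal.coe_lt_coe_iff] at h1 h2
    have := min_le_left s (1 - t)
    have := min_le_right s (1 - t)
    constructor <;> linarith
  · refine summable_case hξ hdef herr hα (of_tendsto_one ?_) (of_iInf hcc)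
    simpa using hαγ.sub hα
  · obtain ⟨θ, hθ, hγ'⟩ := of_tendsto_one hγ
    obtain ⟨c₀, hc₀, hcc'⟩ := of_atTop hcc
    -- Here the defects are negligible relative to `α`, hence relative to `1 - ξ`.
    have hle : ∀ k t, 0 ≤ t → α k * t ≤ (1 - SetValued.xi β γ k) * t := fun k t ht =>
      mul_le_mul_of_nonneg_right (by linarith [hξ k]) ht
    refine SetValued.tendsto_of_isGeneralizedPPA hA hpA hp hc hx hsum
      (fun k => by rw [abs_of_pos (hα01 k).1]; exact hξ k) hα
      (ρ := fun k => |(1 - α k - β k - γ k) / α k| + ‖(α k)⁻¹ • (δ k • e k)‖) (σ := fun _ => 0)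
      (fun k => by positivity) (by simpa using hdef.abs.add herr.norm) (fun _ => le_rfl)
      summable_zero (fun k => ?_) (fun k => ?_) hθ hγ' hc₀ hcc'
    · rw [add_zero]
      refine le_trans ?_ (hle k _ (by positivity))
      have h : α k * |(1 - α k - β k - γ k) / α k| = |1 - α k - β k - γ k| := by
        rw [abs_div, abs_of_pos (hα01 k).1, mul_div_cancel₀ _ (hα01 k).1.ne']
      rw [mul_add, h]
      exact le_add_of_nonneg_right (mul_nonneg (hα01 k).1.le (norm_nonneg _))
    · rw [add_zero]
      refine le_trans ?_ (hle k _ (by positivity))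
      have h : α k * ‖(α k)⁻¹ • (δ k • e k)‖ = ‖δ k • e k‖ := by
        rw [norm_smul, norm_inv, Real.norm_eq_abs, abs_of_pos (hα01 k).1,
          mul_inv_cancel_left₀ (hα01 k).1.ne']
      rw [mul_add, h]
      exact le_add_of_nonneg_left (mul_nonneg (hα01 k).1.le (abs_nonneg _))
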